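/- All Banach spaces are over the real field. For a compact Hausdorff space $K$ and a Banach space $X$, let $C(K,X)$ be the Banach space of continuous functions $f\colon K\to X$ with the supremum norm, and put $C(K)=C(K,\mathbb{R})$. For a Banach space $E$, let $c_0(E)$ and $\ell_\infty(E)$ be the Banach spaces of sequences $(x_n)_{n\in\mathbb{N}}$ in $E$ with $\|x_n\|\to 0$, respectively $\sup_n\|x_n\|<\infty$, both with the supremum norm, and put $c_0=c_0(\mathbb{R})$. Write $E\sim F$ if there is a linear bijection $E\to F$ that is bounded and has bounded inverse. A topological space is scattered if each of its nonempty subsets $A$ has a point that is isolated in $A$. **Theorem 4.4.** Let $X$ and $Y$ be nonzero Banach spaces having no subspace isomorphic to $c_0$, and let $K$ and $L$ be compact Hausdorff spaces such that $C(K)\sim c_0(C(K))$ and $C(L)\sim c_0(C(L))$. If $\ell_\infty(C(K,X))\sim\ell_\infty(C(L,Y))$, then $|K|=|L|$; moreover, $K$ is scattered if and only if $L$ is scattered. -/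

import Mathlib

open scoped ENNReal ZeroAtInfty

universe uK uL uX uY

/-- The Banach space of null sequences in `E`, with the supremum norm. -/
abbrev NullSeq (E : Type*) [NormedAddCommGroup E] : Type _ := C₀(ℕ, E)

/-- The Banach space of bounded sequences in `E`, with the supremum norm. -/
abbrev BddSeq (E : Type*) [NormedAddCommGroup E] : Type _ := lp (fun _ : ℕ => E) ∞

/-- Two real normed spaces are isomorphic: there is a linear bijection, bounded in both
directions. -/
def Isomorphic (E F : Type*) [NormedAddCommGroup E] [NormedSpace ℝ E]
    [NormedAddCommGroup F] [NormedSpace ℝ F] : Prop :=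
  Nonempty (E ≃L[ℝ] F)

/-- `E` has a linear subspace which, with the norm of `E`, is isomorphic to `c₀`. -/
def ContainsCopyOfC0 (E : Type*) [NormedAddCommGroup E] [NormedSpace ℝ E] : Prop :=
  ∃ S : Submodule ℝ E, Isomorphic (NullSeq ℝ) S

/-- Every nonempty subset has a point that is isolated in it. -/
def ScatteredSpace (K : Type*) [TopologicalSpace K] : Prop :=
  ∀ A : Set K, A.Nonempty → ∃ x ∈ A, ∃ U : Set K, IsOpen U ∧ U ∩ A = {x}

/-! ### Norms and blocks of null sequences. -/

section NullSequences

variable {E : Type*} [NormedAddCommGroup E]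

/-! The space `c₀(C(K)) ∼ C(K)` is complemented in `ℓ_∞(C(K,X))`, hence also in `ℓ_∞(C(L,Y))`. A
Phillips-type argument, like the one showing that `c₀` is not complemented in `ℓ_∞`, forces finitely
many coordinates to embed some block `C(K)` of `c₀(C(K))` (`exists_block_bounded_below`). This gives
an operator `T : C(K) → C(Fin n × L, Y)` that is bounded below.

Such a `T` is studied pointwise. Every `k ∈ K` is seen by `T` followed by evaluation at some point
(`exists_seesPoint_evalCLM`), while an operator from `C(K)` to a space without `c₀` sees only
countably many points (`countable_setOf_seesPoint`, via Bessaga–Pełczyński). So `K` injects into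
`(Fin n × L) × ℕ`, hence into `L`, which is empty or infinite; symmetry gives equal cardinalities.

If `L` is scattered and `K` is not, `K` maps onto an uncountable compact metrizable `K'`. As `C(K')`
is separable and metrizable images of `L` are countable, the evaluations give only countably many
operators on `C(K')`. Each sees countably many points, so `K'` is countable, a contradiction. -/

theorem NullSeq.norm_apply_le (a : NullSeq E) (n : ℕ) : ‖a n‖ ≤ ‖a‖ := by
  rw [← ZeroAtInftyContinuousMap.norm_toBCF_eq_norm]
  exact a.toBCF.norm_coe_le_norm n

theorem NullSeq.norm_le {a : NullSeq E} {C : ℝ} (hC : 0 ≤ C) (h : ∀ n, ‖a n‖ ≤ C) : ‖a‖ ≤ C := by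
  rw [← ZeroAtInftyContinuousMap.norm_toBCF_eq_norm]
  exact (BoundedContinuousFunction.norm_le hC).2 h

theorem NullSeq.tendsto_zero (a : NullSeq E) :
    Filter.Tendsto (fun n => a n) Filter.atTop (nhds 0) := by
  have := a.zero_at_infty'
  rwa [Filter.cocompact_eq_cofinite, Nat.cofinite_eq_atTop] at this

/-- The null sequence whose only possibly nonzero term is `x`, at position `m`. -/
noncomputable def NullSeq.single (m : ℕ) (x : E) : NullSeq E where
  toFun := Pi.single m x
  continuous_toFun := continuous_of_discreteTopology
  zero_at_infty' := by
    rw [Filter.cocompact_eq_cofinite, Nat.cofinite_eq_atTop]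
    refine tendsto_const_nhds.congr' ?_
    filter_upwards [Filter.eventually_gt_atTop m] with n hn
    rw [Pi.single_eq_of_ne hn.ne']

theorem NullSeq.single_apply (m n : ℕ) (x : E) :
    NullSeq.single m x n = (Pi.single m x : ℕ → E) n := rfl

@[simp] theorem NullSeq.single_same (m : ℕ) (x : E) : NullSeq.single m x m = x := by
  rw [NullSeq.single_apply, Pi.single_eq_same]

theorem NullSeq.single_of_ne {m n : ℕ} (h : n ≠ m) (x : E) : NullSeq.single m x n = 0 := by
  rw [NullSeq.single_apply, Pi.single_eq_of_ne h]

theorem NullSeq.norm_single (m : ℕ) (x : E) : ‖NullSeq.single m x‖ = ‖x‖ := by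
  apply le_antisymm
  · refine NullSeq.norm_le (norm_nonneg _) fun n => ?_
    by_cases h : n = m
    · rw [h, NullSeq.single_same]
    · rw [NullSeq.single_of_ne h, norm_zero]
      exact norm_nonneg _
  · simpa using NullSeq.norm_apply_le (NullSeq.single m x) m

variable [NormedSpace ℝ E]

/-- The inclusion of `E` as the `m`-th block of the space of null sequences. -/
noncomputable def NullSeq.singleL (m : ℕ) : E →L[ℝ] NullSeq E :=
  LinearMap.mkContinuous
    { toFun := NullSeq.single m
      map_add' := fun x y => by
        ext n
        by_cases h : n = m
        · subst h; simp
        · simp [NullSeq.single_of_ne h]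
      map_smul' := fun c x => by
        ext n
        by_cases h : n = m
        · subst h; simp
        · simp [NullSeq.single_of_ne h] } 1
    (fun x => by simp [NullSeq.norm_single])

@[simp] theorem NullSeq.singleL_apply (m : ℕ) (x : E) :
    NullSeq.singleL m x = NullSeq.single m x := rfl

end NullSequences

/-! ### Disjointification and copies of `c₀`. -/

/-- Rosenthal's disjointification lemma for nonnegative matrices with bounded row sums. -/
theorem exists_injective_offDiag_sum_le {δ : ℝ} (hδ : 0 ≤ δ) (j : ℕ) : ∀ a : ℕ → ℕ → ℝ,
    (∀ (n : ℕ) (F : Finset ℕ), n ∉ F → ∑ m ∈ F, a n m ≤ j * δ) →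
    ∃ φ : ℕ → ℕ, Function.Injective φ ∧
      ∀ (n : ℕ) (F : Finset ℕ), n ∉ F → ∑ m ∈ F, a (φ n) (φ m) ≤ δ := by
  induction j with
  | zero =>
    intro a h
    exact ⟨id, Function.injective_id, fun n F hn => (h n F hn).trans (by simpa using hδ)⟩
  | succ j ih =>
    intro a h
    -- Pairing splits `ℕ` into infinitely many infinite classes. Either one class already works, or
    -- each class `p` has a bad index `q p` whose row has mass above `δ` inside that class. The bad
    -- indices form a transversal, on which the bound on row sums drops by `δ`.
    by_cases hp : ∃ p, ∀ (q : ℕ) (F : Finset ℕ), q ∉ F →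
        ∑ m ∈ F, a (Nat.pair p q) (Nat.pair p m) ≤ δ
    · obtain ⟨p, hp⟩ := hp
      exact ⟨Nat.pair p, fun x y hxy => (Nat.pair_eq_pair.1 hxy).2, hp⟩
    · push Not at hp
      choose q F hqF hlt using hp
      have hinj : Function.Injective fun p => Nat.pair p (q p) :=
        fun x y hxy => (Nat.pair_eq_pair.1 hxy).1
      obtain ⟨φ, hφ, hsum⟩ := ih (fun n m => a (Nat.pair n (q n)) (Nat.pair m (q m))) (by
        intro n G hn
        have hdisj : Disjoint (G.image fun p => Nat.pair p (q p)) ((F n).image (Nat.pair n)) := by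
          rw [Finset.disjoint_left]
          intro x hx hx'
          obtain ⟨p, hp, rfl⟩ := Finset.mem_image.1 hx
          obtain ⟨m, -, hm⟩ := Finset.mem_image.1 hx'
          exact hn ((Nat.pair_eq_pair.1 hm).1 ▸ hp)
        have key := h (Nat.pair n (q n))
          ((G.image fun p => Nat.pair p (q p)) ∪ (F n).image (Nat.pair n)) (by
            rw [Finset.mem_union, not_or]
            refine ⟨fun hx => ?_, fun hx => ?_⟩
            · obtain ⟨p, hp, hx⟩ := Finset.mem_image.1 hx
              exact hn ((Nat.pair_eq_pair.1 hx).1 ▸ hp)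
            · obtain ⟨m, hm, hx⟩ := Finset.mem_image.1 hx
              exact hqF n ((Nat.pair_eq_pair.1 hx).2 ▸ hm))
        rw [Finset.sum_union hdisj, Finset.sum_image hinj.injOn,
          Finset.sum_image (fun x _ y _ hxy => (Nat.pair_eq_pair.1 hxy).2)] at key
        have := hlt n
        push_cast at key
        linarith)
      exact ⟨_, hinj.comp hφ, hsum⟩

/-- The signs of `g (y m)` are admissible coefficients. -/
theorem sum_abs_apply_le {ι Y : Type*} [NormedAddCommGroup Y] [NormedSpace ℝ Y] {y : ι → Y} {C : ℝ}
    {s : Finset ι} (hy : ∀ a : ι → ℝ, (∀ m, |a m| ≤ 1) → ‖∑ m ∈ s, a m • y m‖ ≤ C)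
    (g : Y →L[ℝ] ℝ) : ∑ m ∈ s, |g (y m)| ≤ ‖g‖ * C := by
  have h1 : ∑ m ∈ s, |g (y m)| = g (∑ m ∈ s, ((SignType.sign (g (y m)) : ℤ) : ℝ) • y m) := by
    rw [map_sum]
    refine Finset.sum_congr rfl fun m _ => ?_
    rw [map_smul, smul_eq_mul]
    rcases lt_trichotomy (g (y m)) 0 with h | h | h
    · simp [sign_neg h, abs_of_neg h]
    · simp [h]
    · simp [sign_pos h, abs_of_pos h]
  rw [h1]
  refine (le_abs_self _).trans (g.le_of_opNorm_le_of_le le_rfl (hy _ fun m => ?_))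
  rcases lt_trichotomy (g (y m)) 0 with h | h | h
  · simp [sign_neg h]
  · simp [h]
  · simp [sign_pos h]

/-- The Bessaga–Pełczyński theorem: a weakly unconditionally Cauchy series whose terms are bounded
away from zero produces a copy of `c₀`. -/
theorem containsCopyOfC0_of_bounded_sums {Y : Type*} [NormedAddCommGroup Y] [NormedSpace ℝ Y]
    [CompleteSpace Y] {y : ℕ → Y} {C ε : ℝ}
    (hy : ∀ (s : Finset ℕ) (a : ℕ → ℝ), (∀ m, |a m| ≤ 1) → ‖∑ m ∈ s, a m • y m‖ ≤ C)
    (hε : 0 < ε) (hyε : ∀ n, ε ≤ ‖y n‖) : ContainsCopyOfC0 Y := by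
  have hC : 0 ≤ C := by simpa using hy ∅ 0 (by simp)
  choose g hg hgy using fun n =>
    exists_dual_vector ℝ (y n) (hε.trans_le (hyε n)).ne'
  -- Off-diagonal sums are brought down to `ε / 2`, half the lower bound for the diagonal entries
  -- `‖y n‖`.
  obtain ⟨j, hj⟩ := exists_nat_ge (C / (ε / 2))
  rw [div_le_iff₀ (by positivity)] at hj
  obtain ⟨φ, hφ, hsum⟩ := exists_injective_offDiag_sum_le (half_pos hε).le j
    (fun n m => |g n (y m)|) (fun n F _ => (sum_abs_apply_le (hy F) (g n)).trans (by rwa [hg, one_mul]))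
  have hz : ∀ (s : Finset ℕ) (a : ℕ → ℝ) (B : ℝ), 0 ≤ B → (∀ m ∈ s, |a m| ≤ B) →
      ‖∑ m ∈ s, a m • y (φ m)‖ ≤ C * B := by
    intro s a B hB ha
    rcases hB.eq_or_lt with rfl | hB'
    · rw [Finset.sum_eq_zero]
      · simp
      · intro m hm
        rw [abs_nonpos_iff.1 (ha m hm), zero_smul]
    · classical
      -- The coefficients are scaled by `B⁻¹`, transported along `φ`, and set to zero off the image
      -- of `s`, where `a` need not be bounded by `B`.
      have key := hy (s.image φ) (fun k => if k ∈ s.image φ then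
        B⁻¹ * a (Function.invFun φ k) else 0) (by
          intro k
          split_ifs with hk
          · obtain ⟨m, hm, rfl⟩ := Finset.mem_image.1 hk
            rw [Function.leftInverse_invFun hφ, abs_mul, abs_inv, abs_of_pos hB',
              inv_mul_le_iff₀ hB', mul_one]
            exact ha m hm
          · simp)
      rw [Finset.sum_image hφ.injOn] at key
      have e : ∑ m ∈ s, a m • y (φ m) = B • ∑ x ∈ s, (if φ x ∈ s.image φ then
        B⁻¹ * a (Function.invFun φ (φ x)) else 0) • y (φ x) := by
        rw [Finset.smul_sum]
        refine Finset.sum_congr rfl fun m hm => ?_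
        rw [if_pos (Finset.mem_image_of_mem φ hm), Function.leftInverse_invFun hφ, smul_smul,
          ← mul_assoc, mul_inv_cancel₀ hB'.ne', one_mul]
      rw [e, norm_smul, Real.norm_of_nonneg hB, mul_comm]
      exact mul_le_mul_of_nonneg_right key hB
  have hsummable : ∀ a : NullSeq ℝ, Summable fun m => a m • y (φ m) := by
    intro a
    rw [summable_iff_vanishing_norm]
    intro η hη
    have hη' : 0 < η / (C + 1) := by positivity
    obtain ⟨N, hN⟩ := Filter.eventually_atTop.1
      ((NullSeq.tendsto_zero a).norm.eventually_lt_const (by simpa using hη'))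
    refine ⟨Finset.range N, fun t ht => ?_⟩
    refine (hz t a (η / (C + 1)) hη'.le fun m hm => ?_).trans_lt ?_
    · refine (hN m ?_).le
      have := Finset.disjoint_left.1 ht hm
      simpa using this
    · rw [mul_div_assoc', div_lt_iff₀ (by positivity)]
      nlinarith
  let R : NullSeq ℝ →L[ℝ] Y := LinearMap.mkContinuous
    { toFun := fun a => ∑' m, a m • y (φ m)
      map_add' := fun a b => by
        rw [← (hsummable a).tsum_add (hsummable b)]
        exact tsum_congr fun m => add_smul _ _ _
      map_smul' := fun c a => by
        rw [RingHom.id_apply, ← (hsummable a).tsum_const_smul c]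
        exact tsum_congr fun m => mul_smul c (a m) _ } C (fun a => by
      refine le_of_tendsto (hsummable a).hasSum.norm (Filter.Eventually.of_forall fun s => ?_)
      exact hz s a ‖a‖ (norm_nonneg _) fun m _ => NullSeq.norm_apply_le a m)
  have hR : ∀ a, R a = ∑' m, a m • y (φ m) := fun a => rfl
  -- The functional norming `y (φ n)` isolates the `n`-th term up to the off-diagonal error; the
  -- supremum over `n` then gives `hbelow`.
  have hlow : ∀ a n, ε * |a n| - ε / 2 * ‖a‖ ≤ ‖R a‖ := by
    intro a n
    refine ge_of_tendsto (hsummable a).hasSum.norm ?_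
    filter_upwards [Filter.eventually_ge_atTop {n}] with s hs
    have hns : n ∈ s := hs (Finset.mem_singleton_self n)
    have h1 : |g (φ n) (∑ m ∈ s, a m • y (φ m))| ≤ ‖∑ m ∈ s, a m • y (φ m)‖ := by
      simpa using (g (φ n)).le_of_opNorm_le (hg (φ n)).le (∑ m ∈ s, a m • y (φ m))
    refine le_trans ?_ h1
    rw [map_sum, ← Finset.add_sum_erase s _ hns, map_smul, smul_eq_mul, hgy]
    have h2 : |∑ m ∈ s.erase n, g (φ n) (a m • y (φ m))| ≤ ε / 2 * ‖a‖ := by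
      refine (Finset.abs_sum_le_sum_abs _ _).trans ?_
      calc ∑ m ∈ s.erase n, |g (φ n) (a m • y (φ m))|
          ≤ ∑ m ∈ s.erase n, |g (φ n) (y (φ m))| * ‖a‖ := by
            refine Finset.sum_le_sum fun m _ => ?_
            rw [map_smul, smul_eq_mul, abs_mul, mul_comm]
            exact mul_le_mul_of_nonneg_left (NullSeq.norm_apply_le a m) (abs_nonneg _)
        _ ≤ ε / 2 * ‖a‖ := by
            rw [← Finset.sum_mul]
            exact mul_le_mul_of_nonneg_right (hsum n _ (Finset.notMem_erase n s)) (norm_nonneg _)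
    have h3 : ε * |a n| ≤ |a n * ((‖y (φ n)‖ : ℝ))| := by
      rw [abs_mul, abs_norm, mul_comm]
      exact mul_le_mul_of_nonneg_left (hyε _) (abs_nonneg _)
    have h4 := abs_sub_abs_le_abs_sub (a n * ‖y (φ n)‖)
      (-∑ m ∈ s.erase n, g (φ n) (a m • y (φ m)))
    rw [abs_neg, sub_neg_eq_add] at h4
    simp only [RCLike.ofReal_real_eq_id, id_eq]
    linarith
  have hbelow : ∀ a, ‖a‖ ≤ (2 / ε) * ‖R a‖ := by
    intro a
    have h1 : ‖a‖ ≤ (‖R a‖ + ε / 2 * ‖a‖) / ε := by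
      refine NullSeq.norm_le (by positivity) fun n => ?_
      rw [le_div_iff₀ hε, mul_comm, Real.norm_eq_abs]
      linarith [hlow a n]
    rw [le_div_iff₀ hε] at h1
    rw [div_mul_eq_mul_div, le_div_iff₀ hε]
    linarith
  have hanti := R.antilipschitz_of_bound (K := ⟨2 / ε, by positivity⟩) hbelow
  exact ⟨_, ⟨ContinuousLinearMap.equivRange hanti.injective
    (hanti.isClosed_range R.uniformContinuous)⟩⟩

/-! ### Points seen by operators on `C(K)`. -/

/-- The operator `φ` on `C(K)` sees the point `k`: it does not become small on functions of norm
at most one supported in small neighbourhoods of `k`. -/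
def SeesPoint {K : Type*} [TopologicalSpace K] [CompactSpace K] {Y : Type*}
    [NormedAddCommGroup Y] [NormedSpace ℝ Y] (φ : C(K, ℝ) →L[ℝ] Y) (k : K) (ε : ℝ) : Prop :=
  ∀ V ∈ nhds k, ∃ f : C(K, ℝ), ‖f‖ ≤ 1 ∧ (∀ x ∉ V, f x = 0) ∧ ε < ‖φ f‖

section

variable {K : Type*} [TopologicalSpace K] [CompactSpace K]

theorem norm_sum_smul_le_one_of_disjoint_support {f : ℕ → C(K, ℝ)} (hf : ∀ n, ‖f n‖ ≤ 1)
    (hd : Pairwise (Function.onFun (fun f g : C(K, ℝ) => ∀ x, f x = 0 ∨ g x = 0) f))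
    (s : Finset ℕ) (a : ℕ → ℝ) (ha : ∀ m, |a m| ≤ 1) : ‖∑ m ∈ s, a m • f m‖ ≤ 1 := by
  rw [ContinuousMap.norm_le _ zero_le_one]
  intro x
  rw [ContinuousMap.sum_apply]
  by_cases h : ∃ m ∈ s, f m x ≠ 0
  · obtain ⟨m, hm, hmx⟩ := h
    rw [Finset.sum_eq_single_of_mem m hm]
    · rw [ContinuousMap.smul_apply, norm_smul]
      exact mul_le_one₀ (ha m) (norm_nonneg _) (((f m).norm_coe_le_norm x).trans (hf m))
    · intro j _ hj
      have := (hd hj x).resolve_right hmx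
      simp [this]
  · push Not at h
    rw [Finset.sum_eq_zero]
    · simp
    · intro m hm
      simp [h m hm]

variable {Y : Type*} [NormedAddCommGroup Y] [NormedSpace ℝ Y]

/-- Near an accumulation point of seen points one finds disjointly supported functions in the unit
ball whose images stay large; Bessaga–Pełczyński turns these images into a copy of `c₀`. -/
theorem finite_setOf_seesPoint [T2Space K] [CompleteSpace Y] (hY : ¬ ContainsCopyOfC0 Y)
    (φ : C(K, ℝ) →L[ℝ] Y) {ε : ℝ} (hε : 0 < ε) : {k | SeesPoint φ k ε}.Finite := by
  by_contra hinf
  obtain ⟨p, hp⟩ := Set.Infinite.exists_accPt_principal hinf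
  have : Std.Symm fun f g : C(K, ℝ) => ∀ x, f x = 0 ∨ g x = 0 := ⟨fun f g h x => (h x).symm⟩
  -- Keeping `p` out of every support leaves a neighbourhood of `p` free for the next function.
  obtain ⟨f, hf, hd⟩ := exists_seq_of_forall_finset_exists'
    (fun f : C(K, ℝ) => ‖f‖ ≤ 1 ∧ ε < ‖φ f‖ ∧ p ∉ tsupport f)
    (fun f g : C(K, ℝ) => ∀ x, f x = 0 ∨ g x = 0) (by
      intro s hs
      have hW : (⋂ f ∈ s, (tsupport f)ᶜ) ∈ nhds p := by
        rw [Filter.biInter_finset_mem]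
        exact fun f hf => (isClosed_tsupport f).isOpen_compl.mem_nhds (hs f hf).2.2
      rw [accPt_iff_nhds] at hp
      obtain ⟨k, ⟨hkW, hk⟩, hkp⟩ := hp _ hW
      obtain ⟨U, V, hU, hV, hkU, hpV, hUV⟩ := t2_separation hkp
      have hkW' : (⋂ f ∈ s, (tsupport f)ᶜ) ∈ nhds k := by
        rw [Filter.biInter_finset_mem]
        exact fun f hf => (isClosed_tsupport f).isOpen_compl.mem_nhds
          (Set.mem_iInter₂.1 hkW f hf)
      obtain ⟨g, hg1, hg0, hgε⟩ := hk _ (Filter.inter_mem hkW' (hU.mem_nhds hkU))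
      refine ⟨g, ⟨hg1, hgε, fun hpg => ?_⟩, fun f hf x => ?_⟩
      · have hsub : tsupport g ⊆ Vᶜ := by
          refine closure_minimal (fun x hx hxV => hx (hg0 x fun hxU => ?_)) hV.isClosed_compl
          exact Set.disjoint_left.1 hUV hxU.2 hxV
        exact hsub hpg hpV
      · by_cases hx : x ∈ tsupport f
        · exact Or.inr (hg0 x fun hxU => Set.mem_iInter₂.1 hxU.1 f hf hx)
        · exact Or.inl (image_eq_zero_of_notMem_tsupport hx))
  refine hY (containsCopyOfC0_of_bounded_sums (y := fun n => φ (f n)) (C := ‖φ‖) (fun s a ha => ?_)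
    hε fun n => (hf n).2.1.le)
  have : ∑ m ∈ s, a m • φ (f m) = φ (∑ m ∈ s, a m • f m) := by simp [map_sum]
  rw [this]
  exact φ.le_of_opNorm_le_of_le le_rfl
    (norm_sum_smul_le_one_of_disjoint_support (fun n => (hf n).1) hd s a ha) |>.trans (by simp)

theorem countable_setOf_seesPoint [T2Space K] [CompleteSpace Y] (hY : ¬ ContainsCopyOfC0 Y)
    (φ : C(K, ℝ) →L[ℝ] Y) : {k | ∃ ε > 0, SeesPoint φ k ε}.Countable := by
  refine (Set.countable_iUnion fun n : ℕ =>
    (finite_setOf_seesPoint hY φ (Nat.one_div_pos_of_nat (α := ℝ) (n := n))).countable).mono ?_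
  rintro k ⟨ε, hε, hk⟩
  obtain ⟨n, hn⟩ := exists_nat_one_div_lt hε
  refine Set.mem_iUnion.2 ⟨n, fun V hV => ?_⟩
  obtain ⟨f, h1, h2, h3⟩ := hk V hV
  exact ⟨f, h1, h2, hn.trans h3⟩

variable {Λ : Type*} [TopologicalSpace Λ] [CompactSpace Λ]

/-- An operator between spaces of continuous functions which is bounded below is bounded below in
mean, with respect to some positive functional, on the functions with value one at a point. -/
theorem exists_positive_functional {T : C(K, ℝ) →L[ℝ] C(Λ, ℝ)} {c : ℝ}
    (hc : 0 < c) (hT : ∀ f, c * ‖f‖ ≤ ‖T f‖) (k : K) :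
    ∃ (m : C(Λ, ℝ) →L[ℝ] ℝ) (u : ℝ), 0 < u ∧ (∀ F : C(Λ, ℝ), 0 ≤ F → 0 ≤ m F) ∧
      ∀ f : C(K, ℝ), f k = 1 → u ≤ m |T f| := by
  -- Hahn–Banach separates the functions below `c` from those dominating some `|T f|` with `f k =
  -- 1`. The sets are disjoint because such an `f` has norm at least one.
  have hopen : IsOpen {F : C(Λ, ℝ) | Set.MapsTo F Set.univ (Set.Iio c)} :=
    ContinuousMap.isOpen_setOfPred_mapsTo isCompact_univ isOpen_Iio
  have hconv : Convex ℝ {F : C(Λ, ℝ) | Set.MapsTo F Set.univ (Set.Iio c)} := by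
    intro F hF G hG a b ha hb hab x hx
    exact convex_Iio c (hF hx) (hG hx) ha hb hab
  have hconv' : Convex ℝ {F : C(Λ, ℝ) | ∃ f : C(K, ℝ), f k = 1 ∧ ∀ x, |T f x| ≤ F x} := by
    rintro F ⟨f, hf, hfF⟩ G ⟨g, hg, hgG⟩ a b ha hb hab
    refine ⟨a • f + b • g, by simp [hf, hg, hab], fun x => ?_⟩
    simp only [map_add, map_smul, ContinuousMap.add_apply, ContinuousMap.smul_apply, smul_eq_mul]
    refine (abs_add_le _ _).trans ?_
    rw [abs_mul, abs_mul, abs_of_nonneg ha, abs_of_nonneg hb]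
    exact add_le_add (mul_le_mul_of_nonneg_left (hfF x) ha) (mul_le_mul_of_nonneg_left (hgG x) hb)
  have hdisj : Disjoint {F : C(Λ, ℝ) | Set.MapsTo F Set.univ (Set.Iio c)}
      {F : C(Λ, ℝ) | ∃ f : C(K, ℝ), f k = 1 ∧ ∀ x, |T f x| ≤ F x} := by
    rw [Set.disjoint_left]
    rintro F hF ⟨f, hf, hfF⟩
    have h1 : ‖T f‖ < c := by
      rw [ContinuousMap.norm_lt_iff _ hc]
      exact fun x => (hfF x).trans_lt (hF (Set.mem_univ x))
    have h2 : 1 ≤ ‖f‖ := by simpa [hf] using f.norm_coe_le_norm k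
    nlinarith [hT f]
  obtain ⟨m, u, hmu, hum⟩ := geometric_hahn_banach_open hconv hopen hconv' hdisj
  refine ⟨m, u, by simpa using hmu 0 fun x _ => hc, fun F hF => ?_,
    fun f hf => hum _ ⟨f, hf, fun x => le_rfl⟩⟩
  by_contra! hneg
  have hmem : ∀ t : ℝ, 0 ≤ t → u ≤ m (|T 1| + t • F) := fun t ht =>
    hum _ ⟨1, rfl, fun x => le_add_of_nonneg_right (mul_nonneg ht (hF x))⟩
  -- The second set is closed under adding positive multiples of `F`; this multiple would bring `m`
  -- down to `u - 1`.
  have h1 := hmem ((m |T 1| - u + 1) / (-m F)) (by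
    have := hmem 0 le_rfl
    rw [zero_smul, add_zero] at this
    exact div_nonneg (by linarith) (by linarith))
  rw [map_add, map_smul, smul_eq_mul, div_mul_eq_mul_div, mul_div_assoc, div_neg,
    div_self hneg.ne] at h1
  linarith

/-- If an operator `T : C(K) → C(Λ)` is bounded below, then every point of `K` is seen by the
composition of `T` with evaluation at some point of `Λ`. -/
theorem exists_seesPoint_eval [T2Space K] {T : C(K, ℝ) →L[ℝ] C(Λ, ℝ)} {c : ℝ}
    (hc : 0 < c) (hT : ∀ f, c * ‖f‖ ≤ ‖T f‖) (k : K) :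
    ∃ l : Λ, ∃ ε > 0, ∀ V ∈ nhds k, ∃ f : C(K, ℝ), ‖f‖ ≤ 1 ∧ (∀ x ∉ V, f x = 0) ∧ ε < |T f l| := by
  classical
  by_contra! hun
  obtain ⟨m, u, hu, hm, hmT⟩ := exists_positive_functional hc hT k
  have hmono : ∀ F G : C(Λ, ℝ), F ≤ G → m F ≤ m G := fun F G h => by
    have := hm (G - F) (sub_nonneg.2 h)
    rwa [map_sub, sub_nonneg] at this
  have hm1 : 0 ≤ m 1 := hm 1 fun x => zero_le_one
  -- The witness may depend on `l`: `D` lies below the pointwise supremum of `T` over the unit ball.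
  -- A near-maximizer of `m` on `D` will be improved by `|T f|` for some `f` with `f k = 1`, at cost
  -- `2ε`. The choice of `ε` makes the loss `ε + 2ε · m 1 = u / 2`, less than the gain `u`.
  let D : Set C(Λ, ℝ) := {F | ∀ l, ∃ f : C(K, ℝ), ‖f‖ ≤ 1 ∧ F l ≤ T f l}
  have hD0 : (m '' D).Nonempty := ⟨_, 0, fun l => ⟨0, by simp, by simp⟩, rfl⟩
  have hDb : BddAbove (m '' D) := by
    refine ⟨m (‖T‖ • 1), ?_⟩
    rintro _ ⟨F, hF, rfl⟩
    refine hmono _ _ fun l => ?_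
    obtain ⟨f, hf, hFf⟩ := hF l
    refine hFf.trans ((le_abs_self _).trans (((T f).norm_coe_le_norm l).trans ?_))
    simpa using T.le_of_opNorm_le_of_le le_rfl hf
  have hε : 0 < u / (2 * (1 + 2 * m 1)) := by positivity
  set ε := u / (2 * (1 + 2 * m 1)) with hεdef
  obtain ⟨_, ⟨F, hF, rfl⟩, hFs⟩ := exists_lt_of_lt_csSup hD0 (sub_lt_self (sSup (m '' D)) hε)
  -- As `k` is not seen at `l`, cutting `f` off near `k` barely changes `T f l` and frees room `χ`
  -- in the unit ball.
  have hcut : ∀ l : Λ, ∃ χ g : C(K, ℝ), χ k = 1 ∧ (∀ x, χ x ∈ Set.Icc (0 : ℝ) 1) ∧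
      (∀ x, |g x| ≤ 1 - χ x) ∧ F l - 2 * ε < T g l := by
    intro l
    obtain ⟨f, hf, hFf⟩ := hF l
    obtain ⟨V, hV, hVf⟩ := hun l ε hε
    obtain ⟨W, hWV, hW, hkW⟩ := mem_nhds_iff.1 hV
    obtain ⟨χ, h0, h1, h01⟩ := exists_continuous_zero_one_of_isClosed hW.isClosed_compl
      (isClosed_singleton (x := k)) (by simpa using hkW)
    have hfx : ∀ x, |f x| ≤ 1 := fun x => (f.norm_coe_le_norm x).trans hf
    refine ⟨χ, f * (1 - χ), h1 rfl, h01, fun x => ?_, ?_⟩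
    · have := (h01 x).2
      simp only [ContinuousMap.mul_apply, ContinuousMap.sub_apply, ContinuousMap.one_apply, abs_mul]
      rw [abs_of_nonneg (sub_nonneg.2 this)]
      exact mul_le_of_le_one_left (sub_nonneg.2 this) (hfx x)
    · have h2 := hVf (f * χ) (by
        rw [ContinuousMap.norm_le _ zero_le_one]
        intro x
        rw [ContinuousMap.mul_apply, norm_mul]
        refine mul_le_one₀ (hfx x) (norm_nonneg _) ?_
        rw [Real.norm_of_nonneg (h01 x).1]
        exact (h01 x).2) (by
        intro x hx
        have : χ x = 0 := h0 fun h => hx (hWV h)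
        simp [this])
      have h3 : T (f * (1 - χ)) l = T f l - T (f * χ) l := by
        rw [mul_sub, mul_one, map_sub, ContinuousMap.sub_apply]
      linarith [le_abs_self (T (f * χ) l)]
  choose χ g hχk hχ hg hFg using hcut
  obtain ⟨t, -, ht⟩ := isCompact_univ.elim_nhds_subcover
    (fun l : Λ => {l' | F l' - 2 * ε < T (g l) l'}) (fun l _ =>
      (isOpen_lt (by fun_prop) (by fun_prop)).mem_nhds (hFg l))
  have hfk : (∏ l ∈ t, χ l) k = 1 := by
    rw [ContinuousMap.prod_apply]
    exact Finset.prod_eq_one fun l _ => hχk l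
  -- Adding the product of the `χ l` to `g l₀`, with the sign of its image at `l`, stays in the unit
  -- ball and gains the absolute value of that image.
  have hmem : F - (2 * ε) • 1 + |T (∏ l ∈ t, χ l)| ∈ D := by
    intro l
    obtain ⟨l₀, hl₀, hl⟩ := Set.mem_iUnion₂.1 (ht (Set.mem_univ l))
    have hle : ∀ x, 0 ≤ (∏ l ∈ t, χ l) x ∧ (∏ l ∈ t, χ l) x ≤ χ l₀ x := by
      intro x
      rw [ContinuousMap.prod_apply]
      refine ⟨Finset.prod_nonneg fun l _ => (hχ l x).1, ?_⟩
      rw [← Finset.mul_prod_erase t _ hl₀]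
      exact mul_le_of_le_one_right (hχ l₀ x).1
        (Finset.prod_le_one (fun l _ => (hχ l x).1) fun l _ => (hχ l x).2)
    have hbd : ∀ h : C(K, ℝ), (∀ x, |h x| ≤ (∏ l ∈ t, χ l) x) → ‖g l₀ + h‖ ≤ 1 := by
      intro h hh
      rw [ContinuousMap.norm_le _ zero_le_one]
      intro x
      rw [ContinuousMap.add_apply]
      refine (norm_add_le _ _).trans ?_
      have := hg l₀ x
      have := hh x
      have := (hle x).2
      rw [Real.norm_eq_abs, Real.norm_eq_abs]
      linarith
    have hl' : F l - 2 * ε < T (g l₀) l := hl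
    rcases abs_choice (T (∏ l ∈ t, χ l) l) with h | h
    · refine ⟨g l₀ + ∏ l ∈ t, χ l, hbd _ fun x => (abs_of_nonneg (hle x).1).le, ?_⟩
      simp only [ContinuousMap.add_apply, ContinuousMap.sub_apply, ContinuousMap.smul_apply,
        ContinuousMap.one_apply, ContinuousMap.abs_apply, h, map_add, smul_eq_mul]
      linarith
    · refine ⟨g l₀ + -∏ l ∈ t, χ l, hbd _ fun x => ?_, ?_⟩
      · rw [ContinuousMap.neg_apply, abs_neg]
        exact (abs_of_nonneg (hle x).1).le
      simp only [ContinuousMap.add_apply, ContinuousMap.sub_apply, ContinuousMap.smul_apply,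
        ContinuousMap.one_apply, ContinuousMap.abs_apply, h, map_add, smul_eq_mul, map_neg,
        ContinuousMap.neg_apply]
      linarith
  have h1 := le_csSup hDb ⟨_, hmem, rfl⟩
  rw [map_add, map_sub, map_smul, smul_eq_mul] at h1
  have h2 := hmT _ hfk
  have h3 : ε * (2 * (1 + 2 * m 1)) = u := by
    rw [hεdef]
    field_simp
  nlinarith

/-- If an operator `T : C(K) → C(M, Y)` is bounded below, then every point of `K` is seen by the
composition of `T` with evaluation at some point of `M`. -/
theorem exists_seesPoint_evalCLM [T2Space K] {M : Type*} [TopologicalSpace M] [CompactSpace M]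
    {T : C(K, ℝ) →L[ℝ] C(M, Y)} {c : ℝ} (hc : 0 < c) (hT : ∀ f, c * ‖f‖ ≤ ‖T f‖) (k : K) :
    ∃ l : M, ∃ ε > 0, SeesPoint ((ContinuousMap.evalCLM ℝ l).comp T) k ε := by
  -- With the weak-* compact dual ball `B`, `C(M, Y)` embeds isometrically into `C(M × B)`, which
  -- reduces to the scalar case.
  let B : Set (WeakDual ℝ Y) := WeakDual.toStrongDual ⁻¹' Metric.closedBall 0 1
  have hB : ∀ y : B, ‖WeakDual.toStrongDual y.1‖ ≤ 1 := fun y =>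
    mem_closedBall_zero_iff.1 y.2
  have : CompactSpace B := isCompact_iff_compactSpace.1 (WeakDual.isCompact_closedBall 0 1)
  have hcont : ∀ G : C(M, Y), Continuous fun p : M × B => (p.2.1 : WeakDual ℝ Y) (G p.1) := by
    intro G
    rw [continuous_iff_continuousAt]
    rintro ⟨l, y⟩
    have h1 : Filter.Tendsto (fun p : M × B => (p.2.1 : WeakDual ℝ Y) (G p.1 - G l)) (nhds (l, y))
        (nhds 0) := by
      refine squeeze_zero_norm (a := fun p : M × B => ‖G p.1 - G l‖) (fun p => ?_) ?_
      · exact ((WeakDual.toStrongDual p.2.1).le_of_opNorm_le (hB p.2) _).trans (by simp)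
      · have : Continuous fun p : M × B => ‖G p.1 - G l‖ := by fun_prop
        simpa using this.tendsto (l, y)
    have h2 : Filter.Tendsto (fun p : M × B => (p.2.1 : WeakDual ℝ Y) (G l)) (nhds (l, y))
        (nhds ((y.1 : WeakDual ℝ Y) (G l))) :=
      (((WeakDual.eval_continuous (G l)).comp continuous_subtype_val).comp
        continuous_snd).tendsto (l, y)
    simpa [ContinuousAt] using h1.add h2
  let J : C(M, Y) →L[ℝ] C(M × B, ℝ) := LinearMap.mkContinuous
    { toFun := fun G => ⟨_, hcont G⟩
      map_add' := fun G H => by ext p; simp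
      map_smul' := fun a G => by ext p; simp } 1 (fun G => by
      rw [one_mul, ContinuousMap.norm_le _ (norm_nonneg _)]
      rintro ⟨l, y⟩
      exact (((WeakDual.toStrongDual y.1).le_of_opNorm_le (hB y) _).trans (by simp)).trans
        (G.norm_coe_le_norm l))
  have hJ : ∀ G l (y : B), J G (l, y) = (y.1 : WeakDual ℝ Y) (G l) := fun G l y => rfl
  have hJn : ∀ G, ‖G‖ ≤ ‖J G‖ := by
    intro G
    rw [ContinuousMap.norm_le _ (norm_nonneg _)]
    intro l
    obtain ⟨g, hg, hgl⟩ := exists_dual_vector'' ℝ (G l)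
    have := (J G).norm_coe_le_norm (l, ⟨StrongDual.toWeakDual g, by simpa [B] using hg⟩)
    rw [hJ] at this
    refine le_trans ?_ this
    change ‖G l‖ ≤ ‖g (G l)‖
    rw [hgl]
    simp
  obtain ⟨⟨l, y⟩, ε, hε, h⟩ := exists_seesPoint_eval (T := J.comp T) hc
    (fun f => (hT f).trans (hJn _)) k
  refine ⟨l, ε, hε, fun V hV => ?_⟩
  obtain ⟨f, h1, h2, h3⟩ := h V hV
  refine ⟨f, h1, h2, h3.trans_le ?_⟩
  exact ((WeakDual.toStrongDual y.1).le_of_opNorm_le (hB y) (T f l)).trans (by simp)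

end

/-! ### Almost disjoint families and functionals on `ℓ_∞`. -/

/-- The indicator function of a set of natural numbers, as a bounded sequence. -/
noncomputable def indicatorSeq (A : Set ℕ) : BoundedContinuousFunction ℕ ℝ :=
  BoundedContinuousFunction.ofNormedAddCommGroupDiscrete (A.indicator 1) 1 fun n => by
    by_cases h : n ∈ A <;> simp [h]

theorem indicatorSeq_of_mem {A : Set ℕ} {n : ℕ} (h : n ∈ A) : indicatorSeq A n = 1 :=
  Set.indicator_of_mem h 1

theorem indicatorSeq_of_notMem {A : Set ℕ} {n : ℕ} (h : n ∉ A) : indicatorSeq A n = 0 :=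
  Set.indicator_of_notMem h 1

theorem apply_indicatorSeq_diff {v : BoundedContinuousFunction ℕ ℝ →L[ℝ] ℝ}
    (hv : ∀ m, v (indicatorSeq {m}) = 0) (A : Set ℕ) (N : ℕ) :
    v (indicatorSeq (A \ {n | n < N})) = v (indicatorSeq A) := by
  classical
  have : indicatorSeq A = indicatorSeq (A \ {n | n < N}) +
      ∑ m ∈ (Finset.range N).filter (· ∈ A), indicatorSeq {m} := by
    ext n
    rw [BoundedContinuousFunction.add_apply, BoundedContinuousFunction.sum_apply]
    have hs : ∑ m ∈ (Finset.range N).filter (· ∈ A), indicatorSeq {m} n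
        = if n ∈ (Finset.range N).filter (· ∈ A) then 1 else 0 := by
      rw [← Finset.sum_ite_eq ((Finset.range N).filter (· ∈ A)) n fun _ => (1 : ℝ)]
      refine Finset.sum_congr rfl fun m _ => ?_
      split_ifs with h
      · exact indicatorSeq_of_mem h
      · exact indicatorSeq_of_notMem h
    rw [hs]
    by_cases hA : n ∈ A <;> by_cases hN : n < N
    · rw [indicatorSeq_of_mem hA, indicatorSeq_of_notMem (by simp [hN]), if_pos (by simp [hA, hN]),
        zero_add]
    · rw [indicatorSeq_of_mem hA, indicatorSeq_of_mem (A := A \ _) ⟨hA, hN⟩, if_neg (by simp [hN]), add_zero]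
    · rw [indicatorSeq_of_notMem hA, indicatorSeq_of_notMem fun h => hA h.1, if_neg (by simp [hA]),
        add_zero]
    · rw [indicatorSeq_of_notMem hA, indicatorSeq_of_notMem fun h => hA h.1, if_neg (by simp [hA]),
        add_zero]
  conv_rhs => rw [this]
  rw [map_add, map_sum, Finset.sum_eq_zero fun m _ => hv m, add_zero]

theorem norm_sum_smul_indicatorSeq_le {ι : Type*} {s : Finset ι} {A : ι → Set ℕ}
    (hA : ∀ i ∈ s, ∀ j ∈ s, i ≠ j → Disjoint (A i) (A j)) {a : ι → ℝ} (ha : ∀ i, |a i| ≤ 1) :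
    ‖∑ i ∈ s, a i • indicatorSeq (A i)‖ ≤ 1 := by
  rw [BoundedContinuousFunction.norm_le zero_le_one]
  intro n
  rw [BoundedContinuousFunction.sum_apply]
  by_cases h : ∃ i ∈ s, n ∈ A i
  · obtain ⟨i, hi, hn⟩ := h
    rw [Finset.sum_eq_single_of_mem i hi]
    · rw [BoundedContinuousFunction.smul_apply, indicatorSeq_of_mem hn]
      simpa using ha i
    · intro j hj hji
      rw [BoundedContinuousFunction.smul_apply,
        indicatorSeq_of_notMem (Set.disjoint_right.1 (hA j hj i hi hji) hn), smul_zero]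
  · push Not at h
    rw [Finset.sum_eq_zero]
    · simp
    · intro i hi
      rw [BoundedContinuousFunction.smul_apply, indicatorSeq_of_notMem (h i hi), smul_zero]

/-- The members of an almost disjoint family on which a functional vanishing on the unit vectors is
not small are finite in number. -/
theorem finite_setOf_lt_abs_apply_indicatorSeq {ι : Type*} {A : ι → Set ℕ}
    (hA : Pairwise fun i j => (A i ∩ A j).Finite) {v : BoundedContinuousFunction ℕ ℝ →L[ℝ] ℝ}
    (hv : ∀ m, v (indicatorSeq {m}) = 0) {δ : ℝ} (hδ : 0 < δ) :
    {i | δ < |v (indicatorSeq (A i))|}.Finite := by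
  by_contra hinf
  obtain ⟨n, hn⟩ := exists_nat_gt (‖v‖ / δ)
  rw [div_lt_iff₀ hδ] at hn
  obtain ⟨s, hs, hcard⟩ := Set.Infinite.exists_subset_card_eq hinf n
  -- Deleting an initial segment that contains all pairwise intersections makes the chosen sets
  -- disjoint without changing the values of `v`.
  have hfin : (⋃ i ∈ s, ⋃ j ∈ s, ⋃ (_ : i ≠ j), A i ∩ A j).Finite :=
    s.finite_toSet.biUnion fun i _ => s.finite_toSet.biUnion fun j _ =>
      Set.finite_iUnion fun hij => hA hij
  obtain ⟨N, hN⟩ := hfin.bddAbove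
  have hle := sum_abs_apply_le (s := s)
    (y := fun i => indicatorSeq (A i \ {n | n < N + 1})) (C := 1)
    (fun a ha => norm_sum_smul_indicatorSeq_le (fun i hi j hj hij => by
      rw [Set.disjoint_left]
      rintro x ⟨hxi, hxN⟩ ⟨hxj, -⟩
      refine hxN (Nat.lt_succ_of_le (hN ?_))
      simp only [Set.mem_iUnion]
      exact ⟨i, hi, j, hj, hij, hxi, hxj⟩) ha) v
  simp only [apply_indicatorSeq_diff hv] at hle
  have h2 : (n : ℝ) * δ ≤ ∑ i ∈ s, |v (indicatorSeq (A i))| := by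
    rw [← hcard, ← nsmul_eq_mul]
    exact Finset.card_nsmul_le_sum _ _ _ fun i hi => (hs hi).le
  linarith

/-- The set of codes of the initial segments of a set of natural numbers. -/
noncomputable def initialSegmentCodes (x : Set ℕ) : Set ℕ :=
  open Classical in
  Set.range fun n : ℕ => Encodable.encode (n, (Finset.range n).filter (· ∈ x))

theorem infinite_initialSegmentCodes (x : Set ℕ) : (initialSegmentCodes x).Infinite :=
  Set.infinite_range_of_injective fun n m h => by
    simpa using congrArg Prod.fst (Encodable.encode_injective h)

/-- Initial segments longer than a point where the two sets differ are distinct. -/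
theorem finite_initialSegmentCodes_inter :
    Pairwise fun x y => (initialSegmentCodes x ∩ initialSegmentCodes y).Finite := by
  classical
  intro x y hxy
  obtain ⟨i, hi⟩ : ∃ i, ¬ (i ∈ x ↔ i ∈ y) := by
    by_contra! h
    exact hxy (Set.ext h)
  refine ((Finset.range (i + 1)).finite_toSet.image
    fun n : ℕ => Encodable.encode (n, (Finset.range n).filter (· ∈ x))).subset ?_
  rintro _ ⟨⟨n, rfl⟩, ⟨m, hm⟩⟩
  have h := Encodable.encode_injective hm
  rw [Prod.mk.injEq] at h
  obtain ⟨rfl, h⟩ := h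
  refine ⟨m, ?_, by simp⟩
  by_contra hmi
  have hmi' : i < m := by
    simp only [Finset.coe_range, Set.mem_Iio] at hmi
    omega
  have := Finset.ext_iff.1 h i
  simp only [Finset.mem_filter, Finset.mem_range, hmi', true_and] at this
  exact hi this.symm

/-- Each `v k` is nonzero on only countably many members of an almost disjoint family indexed by all
sets of naturals, so some member is annihilated by all of them. -/
theorem exists_infinite_apply_indicatorSeq_eq_zero
    (v : ℕ → BoundedContinuousFunction ℕ ℝ →L[ℝ] ℝ) (hv : ∀ k m, v k (indicatorSeq {m}) = 0) :
    ∃ A : Set ℕ, A.Infinite ∧ ∀ k, v k (indicatorSeq A) = 0 := by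
  have hcount : (⋃ (k : ℕ) (j : ℕ),
      {x | 1 / ((j : ℝ) + 1) < |v k (indicatorSeq (initialSegmentCodes x))|}).Countable :=
    Set.countable_iUnion fun k => Set.countable_iUnion fun j =>
      (finite_setOf_lt_abs_apply_indicatorSeq finite_initialSegmentCodes_inter (hv k)
        Nat.one_div_pos_of_nat).countable
  have hne : (⋃ (k : ℕ) (j : ℕ),
      {x | 1 / ((j : ℝ) + 1) < |v k (indicatorSeq (initialSegmentCodes x))|}) ≠ Set.univ := by
    intro h
    rw [h, Set.countable_univ_iff] at hcount
    obtain ⟨f, hf⟩ := exists_injective_nat (Set ℕ)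
    exact Function.cantor_injective f hf
  obtain ⟨x, hx⟩ := (Set.ne_univ_iff_exists_notMem _).1 hne
  refine ⟨_, infinite_initialSegmentCodes x, fun k => ?_⟩
  by_contra hk
  obtain ⟨j, hj⟩ := exists_nat_one_div_lt (abs_pos.2 hk)
  exact hx (Set.mem_iUnion₂.2 ⟨k, j, hj⟩)

/-! ### Complemented copies of `c₀(E)` in `ℓ_∞(F)`. -/

section

variable {E F : Type*} [NormedAddCommGroup E] [NormedSpace ℝ E] [NormedAddCommGroup F]
  [NormedSpace ℝ F]

/-- Evaluation of a null sequence at an index. -/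
noncomputable def NullSeq.evalL (m : ℕ) : NullSeq E →L[ℝ] E :=
  LinearMap.mkContinuous
    { toFun := fun a => a m
      map_add' := fun _ _ => rfl
      map_smul' := fun _ _ => rfl } 1
    (fun a => by simpa using NullSeq.norm_apply_le a m)

@[simp] theorem NullSeq.evalL_apply (m : ℕ) (a : NullSeq E) : NullSeq.evalL m a = a m := rfl

/-- If a block of normalized vectors of `c₀(E)` is sent by `T` to a sequence in `ℓ_∞(F)` that tends
to zero fast in each coordinate, then `T` extends from the span of the block to `ℓ_∞`. -/
theorem exists_extension_to_bounded [CompleteSpace F] (T : NullSeq E →L[ℝ] BddSeq F) {z : ℕ → E}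
    (hz : ∀ m, ‖z m‖ ≤ 1)
    (hTz : ∀ m i, i ≤ m → ‖(T (NullSeq.single m (z m)) : ℕ → F) i‖ ≤ (1 / 2) ^ m) :
    ∃ R : BoundedContinuousFunction ℕ ℝ →L[ℝ] BddSeq F,
      ∀ m, R (indicatorSeq {m}) = T (NullSeq.single m (z m)) := by
  let w : ℕ → ℕ → F := fun m => T (NullSeq.single m (z m))
  have hsum : ∀ (a : BoundedContinuousFunction ℕ ℝ) (i : ℕ), Summable fun m => a m • w m i := by
    intro a i
    refine Summable.of_norm_bounded_eventually_nat
      (g := fun m => ‖a‖ * (1 / 2 : ℝ) ^ m) (summable_geometric_two.mul_left _) ?_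
    filter_upwards [Filter.eventually_ge_atTop i] with m hm
    rw [norm_smul]
    exact mul_le_mul (a.norm_coe_le_norm m) (hTz m i hm) (norm_nonneg _) (norm_nonneg _)
  -- Partial sums are coordinates of `T` at finite block combinations of norm at most `‖a‖`, so the
  -- bound is uniform in `i` and `s`.
  have hfin : ∀ (a : BoundedContinuousFunction ℕ ℝ) (i : ℕ) (s : Finset ℕ),
      ‖∑ m ∈ s, a m • w m i‖ ≤ ‖T‖ * ‖a‖ := by
    intro a i s
    have h1 : ∑ m ∈ s, a m • w m i
        = (T (∑ m ∈ s, a m • NullSeq.single m (z m)) : ℕ → F) i := by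
      rw [map_sum, lp.coeFn_sum, Finset.sum_apply]
      refine Finset.sum_congr rfl fun m _ => ?_
      rw [map_smul]
      rfl
    rw [h1]
    refine (lp.norm_apply_le_norm ENNReal.top_ne_zero _ i).trans
      (T.le_of_opNorm_le_of_le le_rfl (NullSeq.norm_le (norm_nonneg _) fun n => ?_))
    have h2 : (∑ m ∈ s, a m • NullSeq.single m (z m)) n
        = ∑ m ∈ s, (a m • NullSeq.single m (z m) n) := by
      rw [← NullSeq.evalL_apply, map_sum]
      rfl
    rw [h2]
    by_cases hn : n ∈ s
    · rw [Finset.sum_eq_single_of_mem n hn]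
      · rw [NullSeq.single_same, norm_smul]
        exact (mul_le_of_le_one_right (norm_nonneg _) (hz n)).trans (a.norm_coe_le_norm n)
      · intro m _ hm
        rw [NullSeq.single_of_ne hm.symm, smul_zero]
    · rw [Finset.sum_eq_zero]
      · simp
      · intro m hm
        rw [NullSeq.single_of_ne (fun h : n = m => hn (h ▸ hm)), smul_zero]
  have hbd : ∀ (a : BoundedContinuousFunction ℕ ℝ) (i : ℕ),
      ‖∑' m, a m • w m i‖ ≤ ‖T‖ * ‖a‖ := fun a i =>
    le_of_tendsto (hsum a i).hasSum.norm (Filter.Eventually.of_forall fun s => hfin a i s)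
  let R : BoundedContinuousFunction ℕ ℝ →L[ℝ] BddSeq F := LinearMap.mkContinuous
    { toFun := fun a => ⟨fun i => ∑' m, a m • w m i, memℓp_infty ⟨‖T‖ * ‖a‖, by
        rintro _ ⟨i, rfl⟩
        exact hbd a i⟩⟩
      map_add' := fun a b => by
        ext i
        change ∑' m, (a + b) m • w m i = ∑' m, a m • w m i + ∑' m, b m • w m i
        rw [← (hsum a i).tsum_add (hsum b i)]
        exact tsum_congr fun m => add_smul _ _ _
      map_smul' := fun c a => by
        ext i
        change ∑' m, (c • a) m • w m i = c • ∑' m, a m • w m i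
        rw [← (hsum a i).tsum_const_smul c]
        exact tsum_congr fun m => mul_smul c (a m) _ } ‖T‖ (fun a =>
      lp.norm_le_of_forall_le (by positivity) fun i => hbd a i)
  refine ⟨R, fun m => ?_⟩
  ext i
  change ∑' j, indicatorSeq {m} j • w j i = w m i
  rw [tsum_eq_single m]
  · rw [indicatorSeq_of_mem (Set.mem_singleton _), one_smul]
  · intro j hj
    rw [indicatorSeq_of_notMem (A := {m}) hj, zero_smul]

/-- If `c₀(E)` is complemented in `ℓ_∞(F)`, then finitely many coordinates of `ℓ_∞(F)` suffice to
embed some block of `c₀(E)`. -/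
theorem exists_block_bounded_below [CompleteSpace F] (T : NullSeq E →L[ℝ] BddSeq F)
    (S : BddSeq F →L[ℝ] NullSeq E) (hST : ∀ x, S (T x) = x) :
    ∃ (n m : ℕ) (c : ℝ), 0 < c ∧
      ∀ x : E, ∃ i < n, c * ‖x‖ ≤ ‖(T (NullSeq.single m x) : ℕ → F) i‖ := by
  by_contra! h
  choose x hx using fun m : ℕ => h (m + 1) m ((1 / 2) ^ m) (by positivity)
  have hx0 : ∀ m, 0 < ‖x m‖ := fun m =>
    pos_of_mul_pos_right ((norm_nonneg _).trans_lt (hx m 0 (Nat.succ_pos m))) (by positivity)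
  have hz : ∀ m, ‖‖x m‖⁻¹ • x m‖ = 1 := fun m => by
    rw [norm_smul, norm_inv, norm_norm, inv_mul_cancel₀ (hx0 m).ne']
  obtain ⟨R, hR⟩ := exists_extension_to_bounded T (z := fun m => ‖x m‖⁻¹ • x m)
    (fun m => (hz m).le) (fun m i hi => by
      rw [← NullSeq.singleL_apply, map_smul, map_smul, lp.coeFn_smul, Pi.smul_apply, norm_smul,
        norm_inv, norm_norm, inv_mul_le_iff₀ (hx0 m), mul_comm]
      exact (hx m i (Nat.lt_succ_of_le hi)).le)
  choose g hg hgz using fun m => exists_dual_vector ℝ (‖x m‖⁻¹ • x m) (by rw [hz]; exact one_ne_zero)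
  -- These functionals compare `a j` with the `j`-th block of `S (R a)` and vanish on unit vectors.
  -- On the indicator of `A` they force blocks of norm at least one for all `j ∈ A`, impossible for
  -- a null sequence.
  obtain ⟨A, hA, hvA⟩ := exists_infinite_apply_indicatorSeq_eq_zero
    (fun j => BoundedContinuousFunction.evalCLM ℝ j -
      (g j).comp ((NullSeq.evalL j).comp (S.comp R))) (by
      intro j m
      simp only [sub_apply, ContinuousLinearMap.comp_apply, hR, hST,
        NullSeq.evalL_apply, BoundedContinuousFunction.evalCLM_apply]
      by_cases hj : j = m
      · subst hj
        rw [NullSeq.single_same, hgz, hz, indicatorSeq_of_mem (Set.mem_singleton _)]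
        simp
      · rw [NullSeq.single_of_ne hj, map_zero, indicatorSeq_of_notMem (A := {m}) hj, sub_zero])
  have hlim := (NullSeq.tendsto_zero (S (R (indicatorSeq A)))).norm
  rw [norm_zero] at hlim
  obtain ⟨N, hN⟩ := Filter.eventually_atTop.1 (hlim.eventually_lt_const zero_lt_one)
  obtain ⟨j, hjA, hj⟩ := hA.exists_gt N
  have h1 := hvA j
  simp only [sub_apply, ContinuousLinearMap.comp_apply,
    NullSeq.evalL_apply, BoundedContinuousFunction.evalCLM_apply, indicatorSeq_of_mem hjA] at h1
  have h2 := (le_abs_self _).trans ((g j).le_of_opNorm_le (hg j).le (S (R (indicatorSeq A)) j))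
  rw [one_mul] at h2
  linarith [hN j hj.le]

end

/-! ### Scattered compacta and their metrizable images. -/

/-- The image of a compact scattered space does not contain nonempty perfect sets. -/
theorem ScatteredSpace.eq_empty_of_perfect_subset_range {L W : Type*} [TopologicalSpace L]
    [CompactSpace L] [TopologicalSpace W] [T2Space W] (hL : ScatteredSpace L) {q : L → W}
    (hq : Continuous q) {D : Set W} (hD : Perfect D) (hDq : D ⊆ Set.range q) : D = ∅ := by
  by_contra hne
  obtain ⟨d₀, hd₀⟩ := Set.nonempty_iff_ne_empty.2 hne
  -- For a minimal closed `N` whose image covers `D`, removing an isolated point `x` of `N` must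
  -- uncover some `d ∈ D`. Then `d = q x` is isolated in `D`.
  obtain ⟨N, ⟨hNc, hNq⟩, hmin⟩ := zorn_superset {N : Set L | IsClosed N ∧ D ⊆ q '' N} (by
    intro c hc hchain
    rcases c.eq_empty_or_nonempty with rfl | hcne
    · exact ⟨Set.univ, ⟨isClosed_univ, by rwa [Set.image_univ]⟩, by simp⟩
    refine ⟨⋂₀ c, ⟨isClosed_sInter fun N hN => (hc hN).1, fun d hd => ?_⟩,
      fun N hN => Set.sInter_subset_of_mem hN⟩
    have : Nonempty c := hcne.to_subtype
    have hcl : ∀ N : c, IsClosed (N.1 ∩ q ⁻¹' {d}) := fun N =>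
      (hc N.2).1.inter (isClosed_singleton.preimage hq)
    obtain ⟨x, hx⟩ := IsCompact.nonempty_iInter_of_directed_nonempty_isCompact_isClosed
      (fun N : c => N.1 ∩ q ⁻¹' {d}) (by
        rintro ⟨N, hN⟩ ⟨N', hN'⟩
        rcases hchain.total hN hN' with h | h
        · exact ⟨⟨N, hN⟩, subset_rfl, Set.inter_subset_inter_left _ h⟩
        · exact ⟨⟨N', hN'⟩, Set.inter_subset_inter_left _ h, subset_rfl⟩)
      (fun N => by
        obtain ⟨x, hx, hxd⟩ := (hc N.2).2 hd
        exact ⟨x, hx, hxd⟩) (fun N => (hcl N).isCompact) hcl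
    rw [Set.mem_iInter] at hx
    exact ⟨x, fun N hN => (hx ⟨N, hN⟩).1, (hx ⟨_, hcne.choose_spec⟩).2⟩)
  obtain ⟨x₀, hx₀, -⟩ := hNq hd₀
  obtain ⟨x, hxN, U, hU, hUN⟩ := hL N ⟨x₀, hx₀⟩
  have hxU : x ∈ U := (hUN.symm ▸ Set.mem_singleton x : x ∈ U ∩ N).1
  have hclosed : IsClosed (N \ U) := hNc.sdiff hU
  obtain ⟨d, hd, hdN⟩ : ∃ d ∈ D, d ∉ q '' (N \ U) := by
    by_contra! hsub
    exact (hmin ⟨hclosed, hsub⟩ Set.sdiff_subset hxN).2 hxU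
  have hoff : ∀ y ∈ N, q y ∉ q '' (N \ U) → y = x := fun y hy hyq => by
    by_contra hyx
    exact hyq ⟨y, ⟨hy, fun hyU => hyx (hUN ▸ ⟨hyU, hy⟩ : y ∈ ({x} : Set L))⟩, rfl⟩
  obtain ⟨y, hy, rfl⟩ := hNq hd
  obtain rfl := hoff y hy hdN
  obtain ⟨w, ⟨hwV, hwD⟩, hw⟩ := accPt_iff_nhds.1 (hD.acc _ hd) (q '' (N \ U))ᶜ
    ((hclosed.isCompact.image hq).isClosed.isOpen_compl.mem_nhds hdN)
  obtain ⟨z, hz, rfl⟩ := hNq hwD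
  exact hw (congrArg q (hoff z hz hwV))

/-- An uncountable compact metrizable space contains a nonempty perfect set. -/
theorem ScatteredSpace.countable_range {L W : Type*} [TopologicalSpace L]
    [CompactSpace L] [TopologicalSpace W] [TopologicalSpace.MetrizableSpace W]
    (hL : ScatteredSpace L) {q : L → W} (hq : Continuous q) : (Set.range q).Countable := by
  by_contra hunc
  have : CompactSpace (Set.range q) := isCompact_iff_compactSpace.1 (isCompact_range hq)
  let := TopologicalSpace.metrizableSpaceMetric W
  have : SecondCountableTopology (Set.range q) := EMetric.secondCountable_of_sigmaCompact _
  obtain ⟨D, hD, hDne, -⟩ := exists_perfect_nonempty_of_isClosed_of_not_countable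
    (C := (Set.univ : Set (Set.range q))) isClosed_univ (by rwa [Set.countable_univ_iff])
  exact hDne.ne_empty (hL.eq_empty_of_perfect_subset_range (hq.rangeFactorization) hD (by
    rw [Set.rangeFactorization_surjective.range_eq]
    exact Set.subset_univ _))

theorem not_countable_range_of_surjective_bits {α : Type*} {g : α → ℕ → ℝ}
    (h : ∀ x : ℕ → Bool, ∃ a, ∀ n, g a n = if x n then 1 else 0) : ¬ (Set.range g).Countable := by
  classical
  intro hc
  choose p hp using h
  have hinj : Function.Injective fun s : Set ℕ =>
      (⟨g (p fun n => decide (n ∈ s)), Set.mem_range_self _⟩ : Set.range g) := by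
    intro s t hst
    ext n
    have := congrFun (congrArg Subtype.val hst) n
    simp only [hp, decide_eq_true_eq] at this
    by_cases hs : n ∈ s <;> by_cases ht : n ∈ t <;> simp_all
  have : Countable (Set.range g) := hc.to_subtype
  have : Countable (Set ℕ) := hinj.countable
  obtain ⟨f, hf⟩ := exists_injective_nat (Set ℕ)
  exact Function.cantor_injective f hf

/-- A compact Hausdorff space which is not scattered has an uncountable metrizable continuous
image. -/
theorem exists_not_countable_range_of_not_scattered {K : Type*} [TopologicalSpace K]
    [CompactSpace K] [T2Space K] (hK : ¬ ScatteredSpace K) :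
    ∃ g : K → ℕ → ℝ, Continuous g ∧ ¬ (Set.range g).Countable := by
  unfold ScatteredSpace at hK
  push Not at hK
  obtain ⟨A, hA, hiso⟩ := hK
  have hsplit : ∀ U : {U : Set K // IsOpen U ∧ (U ∩ A).Nonempty},
      ∃ V : Bool → {U : Set K // IsOpen U ∧ (U ∩ A).Nonempty},
        (∀ b, closure (V b).1 ⊆ U.1) ∧ Disjoint (closure (V true).1) (closure (V false).1) := by
    rintro ⟨U, hU, x, hxU, hxA⟩
    obtain ⟨y, ⟨hyU, hyA⟩, hyx⟩ : ∃ y ∈ U ∩ A, y ≠ x := by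
      by_contra! hall
      exact hiso x hxA U hU (Set.eq_singleton_iff_unique_mem.2 ⟨⟨hxU, hxA⟩, hall⟩)
    obtain ⟨u, hyu, hu, v, hxv, hv, huv⟩ := exists_open_nhds_disjoint_closure hyx
    have hshrink : ∀ z ∈ U, ∃ W, IsOpen W ∧ z ∈ W ∧ closure W ⊆ U := fun z hz => by
      obtain ⟨t, ht, htc, htU⟩ := exists_mem_nhds_isClosed_subset (hU.mem_nhds hz)
      obtain ⟨W, hWt, hW, hzW⟩ := mem_nhds_iff.1 ht
      exact ⟨W, hW, hzW, (closure_minimal hWt htc).trans htU⟩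
    obtain ⟨Wy, hWy, hyW, hWyU⟩ := hshrink y hyU
    obtain ⟨Wx, hWx, hxW, hWxU⟩ := hshrink x hxU
    refine ⟨fun b => if b then ⟨u ∩ Wy, hu.inter hWy, y, ⟨hyu, hyW⟩, hyA⟩ else
      ⟨v ∩ Wx, hv.inter hWx, x, ⟨hxv, hxW⟩, hxA⟩, fun b => ?_, ?_⟩
    · cases b
      · exact (closure_mono Set.inter_subset_right).trans hWxU
      · exact (closure_mono Set.inter_subset_right).trans hWyU
    · exact huv.mono (closure_mono Set.inter_subset_left) (closure_mono Set.inter_subset_left)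
  choose V hVsub hVdisj using hsplit
  -- A Cantor scheme of open sets meeting `A`; the newest bit is the head of the list.
  let D : List Bool → {U : Set K // IsOpen U ∧ (U ∩ A).Nonempty} := fun s =>
    s.rec ⟨Set.univ, isOpen_univ, by simpa using hA⟩ fun b _ U => V U b
  have hDcons : ∀ b s, D (b :: s) = V (D s) b := fun b s => rfl
  have hDsub : ∀ b s, closure (D (b :: s)).1 ⊆ (D s).1 := fun b s => hVsub (D s) b
  have hDbool : ∀ s b b' x, x ∈ closure (D (b :: s)).1 → x ∈ closure (D (b' :: s)).1 → b = b' := by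
    intro s b b' x hx hx'
    cases b <;> cases b'
    · rfl
    · exact (Set.disjoint_left.1 (hVdisj (D s)) hx' hx).elim
    · exact (Set.disjoint_left.1 (hVdisj (D s)) hx hx').elim
    · rfl
  have hDeq : ∀ s t : List Bool, s.length = t.length → ∀ x ∈ (D s).1, x ∈ (D t).1 → s = t := by
    intro s
    induction s with
    | nil => exact fun t ht _ _ _ => (List.length_eq_zero_iff.1 ht.symm).symm
    | cons b s ih =>
      intro t ht x hx hx'
      cases t with
      | nil => simp at ht
      | cons b' t =>
        obtain rfl := ih t (by simpa using ht) x (hDsub b s (subset_closure hx))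
          (hDsub b' t (subset_closure hx'))
        rw [hDbool s b b' x (subset_closure hx) (subset_closure hx')]
  -- The Urysohn function `r` reads bit `n`; only finitely many closures occur at each level, so
  -- their unions are closed.
  have hr : ∀ n : ℕ, ∃ r : C(K, ℝ), ∀ (b : Bool) (s : List Bool), s.length = n →
      ∀ x ∈ closure (D (b :: s)).1, r x = if b then 1 else 0 := by
    intro n
    have hcl : ∀ b, IsClosed (⋃ s ∈ {s : List Bool | s.length = n}, closure (D (b :: s)).1) :=
      fun b => (List.finite_length_eq Bool n).isClosed_biUnion fun _ _ => isClosed_closure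
    obtain ⟨r, h0, h1, -⟩ := exists_continuous_zero_one_of_isClosed (hcl false) (hcl true) (by
      rw [Set.disjoint_left]
      intro x hx hx'
      obtain ⟨s, hs, hxs⟩ := Set.mem_iUnion₂.1 hx
      obtain ⟨t, ht, hxt⟩ := Set.mem_iUnion₂.1 hx'
      obtain rfl := hDeq s t (hs.trans ht.symm) x (hDsub _ _ hxs) (hDsub _ _ hxt)
      exact Bool.noConfusion (hDbool s _ _ x hxs hxt))
    refine ⟨r, fun b s hs x hx => ?_⟩
    cases b
    · exact h0 (Set.mem_iUnion₂.2 ⟨s, hs, hx⟩)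
    · exact h1 (Set.mem_iUnion₂.2 ⟨s, hs, hx⟩)
  choose r hr using hr
  refine ⟨fun k n => r n k, by fun_prop, not_countable_range_of_surjective_bits fun x => ?_⟩
  let s : ℕ → List Bool := fun n => n.rec [] fun i l => x i :: l
  have hs : ∀ n, s (n + 1) = x n :: s n := fun n => rfl
  have hlen : ∀ n, (s n).length = n := by
    intro n
    induction n with
    | zero => rfl
    | succ n ih => rw [hs, List.length_cons, ih]
  obtain ⟨p, hp⟩ := IsCompact.nonempty_iInter_of_sequence_nonempty_isCompact_isClosed
    (fun n => closure (D (s n)).1)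
    (fun n => (hDsub (x n) (s n)).trans subset_closure)
    (fun n => ((D (s n)).2.2.mono Set.inter_subset_left).mono subset_closure)
    isClosed_closure.isCompact (fun n => isClosed_closure)
  exact ⟨p, fun n => hr n (x n) (s n) (hlen n) p (Set.mem_iInter.1 hp (n + 1))⟩

/-! ### Consequences of an operator that is bounded below. -/

section

variable {K L Y : Type*} [TopologicalSpace K] [CompactSpace K] [T2Space K] [TopologicalSpace L]
  [CompactSpace L] [NormedAddCommGroup Y] [NormedSpace ℝ Y] [CompleteSpace Y]

/-- Send `k` to a point `l` that sees it, together with its index among the countably many points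
seen by `l`. -/
theorem nonempty_embedding_prod_nat (hY : ¬ ContainsCopyOfC0 Y) {T : C(K, ℝ) →L[ℝ] C(L, Y)} {c : ℝ}
    (hc : 0 < c) (hT : ∀ f, c * ‖f‖ ≤ ‖T f‖) : Nonempty (K ↪ L × ℕ) := by
  choose l hl using fun k => exists_seesPoint_evalCLM hc hT k
  have hcount : ∀ l : L,
      ∃ e : {k | ∃ ε > 0, SeesPoint ((ContinuousMap.evalCLM ℝ l).comp T) k ε} → ℕ,
        Function.Injective e := fun l => by
    have := (countable_setOf_seesPoint hY ((ContinuousMap.evalCLM ℝ l).comp T)).to_subtype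
    exact exists_injective_nat _
  choose e he using hcount
  refine ⟨⟨fun k => (l k, e (l k) ⟨k, hl k⟩), fun k k' h => ?_⟩⟩
  obtain ⟨h1, h2⟩ := Prod.mk.inj h
  have aux : ∀ (l' : L) (h' : ∃ ε > 0, SeesPoint ((ContinuousMap.evalCLM ℝ l').comp T) k' ε),
      l k = l' → e (l k) ⟨k, hl k⟩ = e l' ⟨k', h'⟩ → k = k' := by
    rintro _ h' rfl h
    exact congrArg Subtype.val (he _ h)
  exact aux _ (hl k') h1 h2

theorem countable_of_scattered [TopologicalSpace.MetrizableSpace K] (hL : ScatteredSpace L)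
    (hY : ¬ ContainsCopyOfC0 Y) {n : ℕ} {T : C(K, ℝ) →L[ℝ] C(Fin n × L, Y)} {c : ℝ}
    (hc : 0 < c) (hT : ∀ f, c * ‖f‖ ≤ ‖T f‖) : Countable K := by
  let := TopologicalSpace.metrizableSpaceMetric K
  have : SecondCountableTopology K := EMetric.secondCountable_of_sigmaCompact _
  let φ : Fin n × L → C(K, ℝ) →L[ℝ] Y := fun p => (ContinuousMap.evalCLM ℝ p).comp T
  -- Since `C(K, ℝ)` is separable, `q i l` determines the operator `φ (i, l)`, and `q i` takes
  -- countably many values because `L` is scattered.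
  let q : Fin n → L → ℕ → Y := fun i l j => T (TopologicalSpace.denseSeq C(K, ℝ) j) (i, l)
  have hq : ∀ i, Continuous (q i) := fun i => by fun_prop
  have hqφ : ∀ i l l', q i l = q i l' → φ (i, l) = φ (i, l') := fun i l l' h => by
    refine DFunLike.coe_injective ((TopologicalSpace.denseRange_denseSeq C(K, ℝ)).equalizer
      (φ (i, l)).continuous (φ (i, l')).continuous (funext fun j => congrFun h j))
  have hcount : (⋃ i : Fin n, ⋃ z ∈ Set.range (q i), ⋂ l ∈ q i ⁻¹' {z},
      {k | ∃ ε > 0, SeesPoint (φ (i, l)) k ε}).Countable := by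
    refine Set.countable_iUnion fun i => ((hL.countable_range (hq i)).biUnion ?_)
    rintro _ ⟨l, rfl⟩
    exact (countable_setOf_seesPoint hY (φ (i, l))).mono (Set.biInter_subset_of_mem rfl)
  rw [← Set.countable_univ_iff]
  refine hcount.mono fun k _ => ?_
  obtain ⟨⟨i, l⟩, hk⟩ := exists_seesPoint_evalCLM hc hT k
  refine Set.mem_iUnion.2 ⟨i, Set.mem_iUnion₂.2 ⟨q i l, ⟨l, rfl⟩,
    Set.mem_iInter₂.2 fun l' hl' => ?_⟩⟩
  rw [Set.mem_ofPred_eq, hqφ i l' l hl']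
  exact hk

theorem ScatteredSpace.of_bounded_below (hL : ScatteredSpace L)
    (hY : ¬ ContainsCopyOfC0 Y) {n : ℕ} {T : C(K, ℝ) →L[ℝ] C(Fin n × L, Y)} {c : ℝ}
    (hc : 0 < c) (hT : ∀ f, c * ‖f‖ ≤ ‖T f‖) : ScatteredSpace K := by
  by_contra hK
  obtain ⟨g, hg, hunc⟩ := exists_not_countable_range_of_not_scattered hK
  have : CompactSpace (Set.range g) := isCompact_iff_compactSpace.1 (isCompact_range hg)
  let π : C(K, Set.range g) := ⟨Set.rangeFactorization g, hg.rangeFactorization⟩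
  let P : C(Set.range g, ℝ) →L[ℝ] C(K, ℝ) := LinearMap.mkContinuous
    { toFun := fun f => f.comp π
      map_add' := fun _ _ => rfl
      map_smul' := fun _ _ => rfl } 1 (fun f => by
      rw [one_mul, ContinuousMap.norm_le _ (norm_nonneg _)]
      exact fun k => f.norm_coe_le_norm _)
  have hP : ∀ f, ‖f‖ ≤ ‖P f‖ := fun f => by
    rw [ContinuousMap.norm_le _ (norm_nonneg _)]
    rintro ⟨_, k, rfl⟩
    exact (P f).norm_coe_le_norm k
  have hcount := countable_of_scattered hL hY (T := T.comp P) hc fun f =>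
    (mul_le_mul_of_nonneg_left (hP f) hc.le).trans (hT _)
  exact hunc (Set.countable_coe_iff.1 hcount)

end

/-! ### Reduction to an operator bounded below, and cardinalities. -/

/-- If `C(L)` is isomorphic to `c₀(C(L))`, then `L` is empty or infinite. -/
theorem infinite_of_isomorphic_nullSeq {L : Type*} [TopologicalSpace L] [CompactSpace L]
    [Nonempty L] (hL : Isomorphic C(L, ℝ) (NullSeq C(L, ℝ))) : Infinite L := by
  by_contra hfin
  rw [not_infinite_iff_finite] at hfin
  obtain ⟨e⟩ := hL
  have : Module.Finite ℝ C(L, ℝ) :=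
    Module.Finite.of_injective (ContinuousMap.coeFnLinearMap ℝ) DFunLike.coe_injective
  have : Module.Finite ℝ (NullSeq C(L, ℝ)) := Module.Finite.equiv e.toLinearEquiv
  have hli : LinearIndependent ℝ fun m => NullSeq.single m (1 : C(L, ℝ)) := by
    rw [linearIndependent_iff']
    intro s a h j hj
    have h1 := congrArg (NullSeq.evalL j) h
    rw [map_sum, Finset.sum_eq_single_of_mem j hj] at h1
    · have h2 := DFunLike.congr_fun h1 (Classical.arbitrary L)
      simpa using h2
    · intro m _ hm
      rw [map_smul, NullSeq.evalL_apply, NullSeq.single_of_ne hm.symm, smul_zero]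
  exact not_finite_iff_infinite.2 inferInstance hli.finite

section

variable {K L X Y : Type*} [TopologicalSpace K] [CompactSpace K] [TopologicalSpace L]
  [CompactSpace L] [NormedAddCommGroup X] [NormedSpace ℝ X] [NormedAddCommGroup Y]
  [NormedSpace ℝ Y]

/-- Coordinate zero carries the functions `f ⊗ x` with `x` of norm one; a functional norming `x`
retracts onto them. -/
theorem exists_complemented_embedding [Nontrivial X] :
    ∃ (I : C(K, ℝ) →L[ℝ] BddSeq C(K, X)) (Q : BddSeq C(K, X) →L[ℝ] C(K, ℝ)), ∀ f, Q (I f) = f := by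
  obtain ⟨x, hx⟩ := exists_ne (0 : X)
  obtain ⟨g, -, hgx⟩ := exists_dual_vector ℝ x (norm_ne_zero_iff.2 hx)
  refine ⟨(lp.singleContinuousLinearMap ℝ (fun _ : ℕ => C(K, X)) ∞ 0).comp
      ((ContinuousLinearMap.toSpanSingleton ℝ (‖x‖⁻¹ • x)).compLeftContinuous ℝ K),
    (g.compLeftContinuous ℝ K).comp (lp.evalCLM ℝ (fun _ : ℕ => C(K, X)) ∞ 0), fun f => ?_⟩
  ext k
  have h0 : lp.evalCLM ℝ (fun _ : ℕ => C(K, X)) ∞ 0 (lp.single ∞ 0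
      ((ContinuousLinearMap.toSpanSingleton ℝ (‖x‖⁻¹ • x)).compLeftContinuous ℝ K f))
      = (ContinuousLinearMap.toSpanSingleton ℝ (‖x‖⁻¹ • x)).compLeftContinuous ℝ K f :=
    Pi.single_eq_same (M := fun _ : ℕ => C(K, X)) 0 _
  rw [ContinuousLinearMap.comp_apply, ContinuousLinearMap.comp_apply,
    lp.singleContinuousLinearMap_apply, h0]
  change g (f k • ‖x‖⁻¹ • x) = f k
  rw [map_smul, map_smul, hgx, smul_eq_mul, smul_eq_mul]
  simp [norm_ne_zero_iff.2 hx]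

theorem exists_bounded_below [Nontrivial X] [CompleteSpace Y]
    (hK : Isomorphic C(K, ℝ) (NullSeq C(K, ℝ)))
    (h : Isomorphic (BddSeq C(K, X)) (BddSeq C(L, Y))) :
    ∃ (n : ℕ) (T : C(K, ℝ) →L[ℝ] C(Fin n × L, Y)) (c : ℝ), 0 < c ∧ ∀ f, c * ‖f‖ ≤ ‖T f‖ := by
  obtain ⟨e⟩ := hK
  obtain ⟨Φ⟩ := h
  obtain ⟨I, Q, hQI⟩ := exists_complemented_embedding (K := K) (X := X)
  obtain ⟨n, m, c, hc, hlow⟩ := exists_block_bounded_below (E := C(K, ℝ)) (F := C(L, Y))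
    ((Φ : BddSeq C(K, X) →L[ℝ] BddSeq C(L, Y)).comp (I.comp (e.symm : _ →L[ℝ] C(K, ℝ))))
    ((e : C(K, ℝ) →L[ℝ] _).comp (Q.comp (Φ.symm : BddSeq C(L, Y) →L[ℝ] _)))
    (fun x => by simp [hQI])
  let U : C(K, ℝ) →L[ℝ] BddSeq C(L, Y) :=
    ((Φ : BddSeq C(K, X) →L[ℝ] BddSeq C(L, Y)).comp (I.comp (e.symm : _ →L[ℝ] C(K, ℝ)))).comp
      (NullSeq.singleL m)
  have hlow' : ∀ f, ∃ i < n, c * ‖f‖ ≤ ‖(U f : ℕ → C(L, Y)) i‖ := hlow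
  -- The finitely many relevant coordinates are merged into one function on `Fin n × L`.
  let T : C(K, ℝ) →L[ℝ] C(Fin n × L, Y) := LinearMap.mkContinuous
    { toFun := fun f => ⟨fun p => (U f : ℕ → C(L, Y)) p.1 p.2,
        continuous_prod_of_discrete_left.2 fun i => ((U f : ℕ → C(L, Y)) i).continuous⟩
      map_add' := fun f g => by
        ext p
        simp
      map_smul' := fun a f => by
        ext p
        simp } ‖U‖ (fun f => by
      rw [ContinuousMap.norm_le _ (by positivity)]
      exact fun p => (((U f : ℕ → C(L, Y)) p.1).norm_coe_le_norm p.2).trans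
        ((lp.norm_apply_le_norm ENNReal.top_ne_zero _ _).trans (U.le_opNorm f)))
  refine ⟨n, T, c, hc, fun f => ?_⟩
  obtain ⟨i, hi, hle⟩ := hlow' f
  refine hle.trans ((ContinuousMap.norm_le _ (norm_nonneg _)).2 fun l => ?_)
  exact (T f).norm_coe_le_norm (⟨i, hi⟩, l)

theorem nonempty_embedding_of_isomorphic [T2Space K] [Nontrivial X] [CompleteSpace Y]
    (hY : ¬ ContainsCopyOfC0 Y) (hK : Isomorphic C(K, ℝ) (NullSeq C(K, ℝ)))
    (hL : Isomorphic C(L, ℝ) (NullSeq C(L, ℝ)))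
    (h : Isomorphic (BddSeq C(K, X)) (BddSeq C(L, Y))) : Nonempty (K ↪ L) := by
  obtain ⟨n, T, c, hc, hT⟩ := exists_bounded_below hK h
  obtain ⟨ι⟩ := nonempty_embedding_prod_nat hY hc hT
  rcases isEmpty_or_nonempty L with hL0 | hL0
  · have : IsEmpty K := Function.isEmpty ι
    exact ⟨Function.Embedding.ofIsEmpty⟩
  · have := infinite_of_isomorphic_nullSeq hL
    have hle : Cardinal.mk ((Fin n × L) × ℕ) ≤ Cardinal.mk L := by
      rw [Cardinal.mk_prod, Cardinal.mk_prod]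
      simp only [Cardinal.lift_uzero, Cardinal.mk_fin, Cardinal.lift_natCast,
        Cardinal.mk_nat, Cardinal.lift_aleph0]
      have hinf := Cardinal.aleph0_le_mk L
      refine Cardinal.mul_le_of_le hinf ?_ hinf
      exact Cardinal.mul_le_of_le hinf ((Cardinal.natCast_le_aleph0).trans hinf) le_rfl
    obtain ⟨j⟩ := Cardinal.lift_mk_le'.1 (Cardinal.lift_le.2 hle)
    exact ⟨ι.trans j⟩

end

theorem theorem4p4
    {K : Type uK} [TopologicalSpace K] [CompactSpace K] [T2Space K]
    {L : Type uL} [TopologicalSpace L] [CompactSpace L] [T2Space L]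
    {X : Type uX} [NormedAddCommGroup X] [NormedSpace ℝ X] [CompleteSpace X] [Nontrivial X]
    {Y : Type uY} [NormedAddCommGroup Y] [NormedSpace ℝ Y] [CompleteSpace Y] [Nontrivial Y]
    (hX : ¬ ContainsCopyOfC0 X) (hY : ¬ ContainsCopyOfC0 Y)
    (hK : Isomorphic C(K, ℝ) (NullSeq C(K, ℝ)))
    (hL : Isomorphic C(L, ℝ) (NullSeq C(L, ℝ)))
    (h : Isomorphic (BddSeq C(K, X)) (BddSeq C(L, Y))) :
    Cardinal.lift.{uL} (Cardinal.mk K) = Cardinal.lift.{uK} (Cardinal.mk L) ∧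
      (ScatteredSpace K ↔ ScatteredSpace L) := by
  have h' : Isomorphic (BddSeq C(L, Y)) (BddSeq C(K, X)) := h.map ContinuousLinearEquiv.symm
  obtain ⟨n, T, c, hc, hT⟩ := exists_bounded_below hK h
  obtain ⟨n', T', c', hc', hT'⟩ := exists_bounded_below hL h'
  exact ⟨le_antisymm (Cardinal.lift_mk_le'.2 (nonempty_embedding_of_isomorphic hY hK hL h))
      (Cardinal.lift_mk_le'.2 (nonempty_embedding_of_isomorphic hX hL hK h')),
    fun hsc => hsc.of_bounded_below hX hc' hT', fun hsc => hsc.of_bounded_below hY hc hT⟩
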